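/- Theorem (Radó's theorem). Let $X$ be a Riemann surface, that is, a connected Hausdorff topological space locally homeomorphic to $\mathbb{C}$ and endowed with a holomorphic atlas (an atlas of charts with values in open subsets of $\mathbb{C}$ whose transition maps are holomorphic); no countability assumption is made on the topology of $X$. Then $X$ is second countable, i.e. its topology has a countable basis. -/

import Mathlib

open scoped Manifold

open Set Filter Topology Metric

/-! The strategy is to remove a small closed chart disc `K` and to construct a pseudo-metric on the
complement directly, without solving a Dirichlet problem or passing to a covering. A
pseudo-metrizable space is paracompact; a connected, locally compact, paracompact Hausdorff space is
σ-compact; a σ-compact pseudo-metric space is second countable. Since `K` lies in one chart domain,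
`X` is then covered by two second countable open sets.

The complement of `K` carries bounded continuous subharmonic functions that are strict near any
prescribed point (`exists_isStrictNear`). Near `K` a radial bump centred in the disc does this, and
bumps in overlapping charts carry strictness along the connected surface.

Such a function yields hyperbolicity near the point. Multiplying a truncated chart distance by the
exponential of a multiple of it gives a bounded function with subharmonic logarithm, and a Schwarz
lemma (`IsDiscOff.le_mul_sqrt`) bounds this function along every holomorphic disc off `K`, uniformly
in the disc (`chartDist_disc_le`). Functions that are equi-Hölder along all such discs therefore
include bumps with small support (`exists_mem_discFamily`). They are also equicontinuous, because
chart discs are themselves admissible (`discFamily_equicontinuousAt`). Their supremum distance thus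
induces the topology of the complement.

Subharmonicity is expressed by harmonic supports from below, so no derivatives of `u` are needed. -/

/-- `u` is touched from below at `x` by `re g + κ * ‖φ - φ x‖ ^ 2` for some `g` holomorphic
near `x`. For `κ = 0` this is subharmonicity at `x`, for `κ > 0` a strict form of it. -/
def HasSupportAt {X : Type*} [TopologicalSpace X] [ChartedSpace ℂ X]
    (u : X → ℝ) (φ : X → ℂ) (κ : ℝ) (x : X) : Prop :=
  ∃ g : X → ℂ, (∀ᶠ y in 𝓝 x, MDifferentiableAt 𝓘(ℂ) 𝓘(ℂ) g y) ∧ (g x).re = u x ∧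
    ∀ᶠ y in 𝓝 x, (g y).re + κ * ‖φ y - φ x‖ ^ 2 ≤ u y

/-! ### Calculus of harmonic supports. -/

namespace HasSupportAt

section Basic

variable {X : Type*} [TopologicalSpace X] [ChartedSpace ℂ X] {u v : X → ℝ} {φ ψ : X → ℂ}
  {κ κ' : ℝ} {x : X}

theorem mono (h : HasSupportAt u φ κ x) (hκ : κ' ≤ κ) : HasSupportAt u φ κ' x := by
  obtain ⟨g, hg, hx, hu⟩ := h
  refine ⟨g, hg, hx, hu.mono fun y hy => le_trans ?_ hy⟩
  gcongr

theorem of_le (h : HasSupportAt u φ κ x) (hle : ∀ᶠ y in 𝓝 x, u y ≤ v y) (hx : u x = v x) :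
    HasSupportAt v φ κ x := by
  obtain ⟨g, hg, hgx, hu⟩ := h
  exact ⟨g, hg, hgx.trans hx, by filter_upwards [hu, hle] with y h1 h2 using h1.trans h2⟩

theorem congr (h : HasSupportAt u φ κ x) (huv : u =ᶠ[𝓝 x] v) : HasSupportAt v φ κ x :=
  h.of_le (huv.mono fun _ hy => hy.le) huv.eq_of_nhds

theorem const (c : ℝ) : HasSupportAt (fun _ : X => c) φ 0 x :=
  ⟨fun _ => (c : ℂ), Eventually.of_forall fun _ => mdifferentiableAt_const, by simp, by simp⟩

theorem change (h : HasSupportAt u φ κ x)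
    (hle : ∀ᶠ y in 𝓝 x, κ' * ‖ψ y - ψ x‖ ^ 2 ≤ κ * ‖φ y - φ x‖ ^ 2) :
    HasSupportAt u ψ κ' x := by
  obtain ⟨g, hg, hx, hu⟩ := h
  refine ⟨g, hg, hx, ?_⟩
  filter_upwards [hu, hle] with y h1 h2
  linarith

theorem zero_change (h : HasSupportAt u φ 0 x) : HasSupportAt u ψ 0 x :=
  h.change (by simp)

theorem add (hu : HasSupportAt u φ κ x) (hv : HasSupportAt v φ κ' x) :
    HasSupportAt (fun y => u y + v y) φ (κ + κ') x := by
  obtain ⟨g, hg, hgx, hgu⟩ := hu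
  obtain ⟨g', hg', hgx', hgu'⟩ := hv
  refine ⟨fun y => g y + g' y, ?_, by simp [hgx, hgx'], ?_⟩
  · filter_upwards [hg, hg'] with y h1 h2 using h1.add h2
  · filter_upwards [hgu, hgu'] with y h1 h2
    simp only [Complex.add_re]
    linarith

theorem const_mul (hu : HasSupportAt u φ κ x) {c : ℝ} (hc : 0 ≤ c) :
    HasSupportAt (fun y => c * u y) φ (c * κ) x := by
  obtain ⟨g, hg, hgx, hgu⟩ := hu
  refine ⟨fun y => (c : ℂ) * g y, ?_, by simp [hgx], ?_⟩
  · filter_upwards [hg] with y h1 using mdifferentiableAt_const.mul h1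
  · filter_upwards [hgu] with y h1
    simp only [Complex.re_ofReal_mul]
    nlinarith [mul_le_mul_of_nonneg_left h1 hc]

theorem comp {Y : Type*} [TopologicalSpace Y] [ChartedSpace ℂ Y] {f : Y → X} {y : Y}
    (h : HasSupportAt u φ κ (f y))
    (hf : ∀ᶠ z in 𝓝 y, MDifferentiableAt 𝓘(ℂ) 𝓘(ℂ) f z) :
    HasSupportAt (u ∘ f) (φ ∘ f) κ y := by
  obtain ⟨g, hg, hx, hu⟩ := h
  have hc : Tendsto f (𝓝 y) (𝓝 (f y)) := hf.self_of_nhds.continuousAt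
  refine ⟨g ∘ f, ?_, hx, hc.eventually hu⟩
  filter_upwards [hc.eventually hg, hf] with z h1 h2 using h1.comp z h2

/-- For holomorphic `h` the function `k * ‖h‖ ^ 2` differs from a harmonic function by exactly
`k * ‖h - h x‖ ^ 2`. -/
theorem mul_norm_sq {h : X → ℂ} (hh : ∀ᶠ y in 𝓝 x, MDifferentiableAt 𝓘(ℂ) 𝓘(ℂ) h y) (k : ℝ) :
    HasSupportAt (fun y => k * ‖h y‖ ^ 2) h k x := by
  refine ⟨fun y => (k : ℂ) * (2 * (starRingEnd ℂ (h x)) * h y - (‖h x‖ ^ 2 : ℝ)), ?_, ?_, ?_⟩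
  · filter_upwards [hh] with y hy
    exact mdifferentiableAt_const.mul ((mdifferentiableAt_const.mul hy).sub mdifferentiableAt_const)
  · rw [Complex.re_ofReal_mul]
    congr 1
    simp only [← Complex.normSq_eq_norm_sq, Complex.normSq_apply, Complex.sub_re, Complex.mul_re,
      Complex.mul_im, Complex.conj_re, Complex.conj_im, Complex.ofReal_re, Complex.re_ofNat,
      Complex.im_ofNat]
    ring
  · refine Eventually.of_forall fun y => le_of_eq ?_
    rw [Complex.re_ofReal_mul]
    rw [← mul_add]
    congr 1
    simp only [← Complex.normSq_eq_norm_sq, Complex.normSq_apply, Complex.sub_re, Complex.mul_re,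
      Complex.mul_im, Complex.conj_re, Complex.conj_im, Complex.ofReal_re, Complex.re_ofNat,
      Complex.im_ofNat, Complex.sub_im]
    ring

end Basic

section Plane

/-- At a local maximum `exp ∘ g` would have locally maximal norm, hence be locally constant, which
leaves no room for the positive quadratic term at points near `z₀`. -/
theorem not_isLocalMax {u : ℂ → ℝ} {κ : ℝ} {z₀ : ℂ} (h : HasSupportAt u id κ z₀) (hκ : 0 < κ) :
    ¬ IsLocalMax u z₀ := by
  intro hmax
  obtain ⟨g, hg, hx, hu⟩ := h
  have key : ∀ᶠ z in 𝓝 z₀, (g z).re + κ * ‖z - z₀‖ ^ 2 ≤ (g z₀).re := by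
    filter_upwards [hu, hmax] with z h1 h2
    rw [hx]
    exact h1.trans h2
  have hd : ∀ᶠ z in 𝓝 z₀, DifferentiableAt ℂ (fun w => Complex.exp (g w)) z := by
    filter_upwards [hg] with z hz using (mdifferentiableAt_iff_differentiableAt.1 hz).cexp
  have hloc : IsLocalMax (norm ∘ fun w => Complex.exp (g w)) z₀ := by
    filter_upwards [key] with z hz
    simp only [Function.comp, Complex.norm_exp, Real.exp_le_exp]
    nlinarith [mul_nonneg hκ.le (sq_nonneg ‖z - z₀‖)]
  have heq := Complex.eventually_eq_of_isLocalMax_norm hd hloc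
  have hall : ∀ᶠ z in 𝓝 z₀, z = z₀ := by
    filter_upwards [heq, key] with z h1 h2
    have h3 := congrArg norm h1
    simp only [Complex.norm_exp, Real.exp_eq_exp] at h3
    have h4 : ‖z - z₀‖ ^ 2 ≤ 0 := by
      by_contra hcon
      nlinarith [mul_pos hκ (not_le.1 hcon)]
    have h5 : ‖z - z₀‖ = 0 := by nlinarith [norm_nonneg (z - z₀)]
    exact sub_eq_zero.1 (norm_eq_zero.1 h5)
  have : (𝓝[≠] z₀).NeBot := inferInstance
  obtain ⟨z, hz, hne⟩ := ((hall.filter_mono nhdsWithin_le_nhds).and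
    (self_mem_nhdsWithin : {z₀}ᶜ ∈ 𝓝[≠] z₀)).exists
  exact hne hz

theorem mul_norm_sub_sq (a : ℂ) (k : ℝ) (z₀ : ℂ) :
    HasSupportAt (fun z => k * ‖z - a‖ ^ 2) id k z₀ := by
  have h := mul_norm_sq (x := z₀) (h := fun z : ℂ => z - a) (Eventually.of_forall fun z =>
    mdifferentiableAt_iff_differentiableAt.2 (by fun_prop)) k
  exact h.change (by simp)

theorem mul_log_norm_sub {a z₀ : ℂ} (h : z₀ ≠ a) (k : ℝ) :
    HasSupportAt (fun z => k * Real.log ‖z - a‖) id 0 z₀ := by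
  have h0 : z₀ - a ≠ 0 := sub_ne_zero.2 h
  -- Dividing by `z₀ - a` moves the base point to `1`, away from the branch cut of the logarithm.
  have hev : ∀ᶠ z in 𝓝 z₀, (z - a) / (z₀ - a) ∈ Complex.slitPlane := by
    have hc : ContinuousAt (fun z => (z - a) / (z₀ - a)) z₀ := by fun_prop
    refine hc.eventually (Complex.isOpen_slitPlane.mem_nhds ?_)
    simp only [div_self h0]
    exact Complex.one_mem_slitPlane
  refine ⟨fun z => (k : ℂ) * (Complex.log ((z - a) / (z₀ - a)) + (Real.log ‖z₀ - a‖ : ℝ)),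
    ?_, ?_, ?_⟩
  · filter_upwards [hev] with z hz
    refine mdifferentiableAt_iff_differentiableAt.2 (DifferentiableAt.const_mul ?_ _)
    refine DifferentiableAt.add_const _ (DifferentiableAt.clog ?_ hz)
    fun_prop
  · simp [div_self h0]
  · filter_upwards [hev] with z hz
    have hz0 : z - a ≠ 0 := fun hz' => Complex.slitPlane_ne_zero hz (by simp [hz'])
    rw [Complex.re_ofReal_mul, Complex.add_re, Complex.log_re, Complex.ofReal_re, norm_div,
      Real.log_div (norm_ne_zero_iff.2 hz0) (norm_ne_zero_iff.2 h0)]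
    simp

end Plane

end HasSupportAt

/-! ### Planar building blocks: bump and logarithmic pole. -/

/-- A `C¹` cutoff of `‖z - c‖⁻²`: the function itself outside the disc of radius `ε`,
continued by the tangent line in `‖z - c‖²` inside. -/
noncomputable def truncInvSq (c : ℂ) (ε : ℝ) (z : ℂ) : ℝ :=
  if ‖z - c‖ ≤ ε then 2 / ε ^ 2 - ‖z - c‖ ^ 2 / ε ^ 4 else (‖z - c‖ ^ 2)⁻¹

/-- A radial bump supported in the disc of radius `R` which is subharmonic off the disc of
radius `ε`. -/
noncomputable def planarBump (c : ℂ) (ε R : ℝ) (z : ℂ) : ℝ :=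
  max 0 (truncInvSq c ε z - (R ^ 2)⁻¹)

section Bump

variable {c z : ℂ} {ε R : ℝ}

/-- Convexity of `t ↦ t⁻¹` in `t = ‖z - c‖ ^ 2`: its graph lies above the tangent at `t = ε ^ 2`. -/
theorem tangent_le_truncInvSq (hε : 0 < ε) (z : ℂ) :
    2 / ε ^ 2 - ‖z - c‖ ^ 2 / ε ^ 4 ≤ truncInvSq c ε z := by
  unfold truncInvSq
  split_ifs with h
  · rfl
  · have hz : 0 < ‖z - c‖ := hε.trans (not_le.1 h)
    rw [← sub_nonneg]
    have : (‖z - c‖ ^ 2)⁻¹ - (2 / ε ^ 2 - ‖z - c‖ ^ 2 / ε ^ 4)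
        = (‖z - c‖ ^ 2 - ε ^ 2) ^ 2 / (‖z - c‖ ^ 2 * ε ^ 4) := by
      field_simp
      ring
    rw [this]
    positivity

theorem continuous_truncInvSq (hε : 0 < ε) : Continuous (truncInvSq c ε) := by
  unfold truncInvSq
  refine continuous_if_le (by fun_prop) continuous_const (by fun_prop) ?_ ?_
  · refine ContinuousOn.inv₀ (by fun_prop) ?_
    intro z hz
    have : 0 < ‖z - c‖ := hε.trans_le hz
    positivity
  · intro z hz
    rw [hz]
    field_simp
    norm_num

theorem continuous_planarBump (hε : 0 < ε) : Continuous (planarBump c ε R) :=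
  continuous_const.max ((continuous_truncInvSq hε).sub continuous_const)

theorem planarBump_nonneg : 0 ≤ planarBump c ε R z := le_max_left _ _

theorem planarBump_le (hε : 0 < ε) : planarBump c ε R z ≤ 2 / ε ^ 2 := by
  refine max_le (by positivity) ?_
  have hR : 0 ≤ (R ^ 2)⁻¹ := by positivity
  unfold truncInvSq
  split_ifs with h
  · have : 0 ≤ ‖z - c‖ ^ 2 / ε ^ 4 := by positivity
    linarith
  · have h1 : (‖z - c‖ ^ 2)⁻¹ ≤ (ε ^ 2)⁻¹ := by
      have := (not_le.1 h).le
      gcongr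
    have h2 : (2 : ℝ) / ε ^ 2 = 2 * (ε ^ 2)⁻¹ := div_eq_mul_inv _ _
    have h3 : 0 ≤ (ε ^ 2)⁻¹ := by positivity
    linarith

theorem planarBump_eq_zero (hε : 0 < ε) (hR : ε < R) (hz : R ≤ ‖z - c‖) :
    planarBump c ε R z = 0 := by
  have h1 : (‖z - c‖ ^ 2)⁻¹ ≤ (R ^ 2)⁻¹ := by
    have : 0 < R := hε.trans hR
    gcongr
  have h2 : ¬ ‖z - c‖ ≤ ε := not_le.2 (hR.trans_le hz)
  simp only [planarBump, truncInvSq, if_neg h2]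
  exact max_eq_left (by linarith)

/-- The tangent expression is a global minorant with equality on the small disc. This measures the
failure of subharmonicity there, which a strictly subharmonic function can later absorb. -/
theorem hasSupportAt_planarBump_inside (hε : 0 < ε) (hR : ε < R) (hz : ‖z - c‖ ≤ ε) :
    HasSupportAt (planarBump c ε R) id (-(1 / ε ^ 4)) z := by
  have h1 := (HasSupportAt.mul_norm_sub_sq c (-(1 / ε ^ 4)) z).add
    (HasSupportAt.const (2 / ε ^ 2 - (R ^ 2)⁻¹))
  rw [add_zero] at h1
  refine h1.of_le (Eventually.of_forall fun w => ?_) ?_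
  · refine le_max_of_le_right ?_
    have := tangent_le_truncInvSq (c := c) hε w
    have h2 : ‖w - c‖ ^ 2 / ε ^ 4 = 1 / ε ^ 4 * ‖w - c‖ ^ 2 := by ring
    linarith
  · have h3 : ‖z - c‖ ^ 2 / ε ^ 4 ≤ 1 / ε ^ 2 := by
      rw [div_le_div_iff₀ (by positivity) (by positivity)]
      have : ‖z - c‖ ^ 2 ≤ ε ^ 2 := by gcongr
      nlinarith [sq_nonneg ε]
    have h4 : (R ^ 2)⁻¹ ≤ 1 / ε ^ 2 := by
      rw [one_div]
      gcongr
    have h5 : (2 : ℝ) / ε ^ 2 = 1 / ε ^ 2 + 1 / ε ^ 2 := by ring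
    simp only [planarBump, truncInvSq, if_pos hz]
    rw [max_eq_right (by linarith)]
    ring

/-- Here the bump is `‖h‖ ^ 2` minus a constant for the holomorphic `h = 1 / (z - c)`, and on the
disc of radius `R` the map `h` expands distances by at least `1 / R ^ 2`. -/
theorem hasSupportAt_planarBump_annulus (hε : 0 < ε) (hz : ε < ‖z - c‖) (hzR : ‖z - c‖ < R) :
    HasSupportAt (planarBump c ε R) id (1 / R ^ 4) z := by
  have hR : 0 < R := (hε.trans hz).trans hzR
  have hev : ∀ᶠ w in 𝓝 z, ε < ‖w - c‖ ∧ ‖w - c‖ < R := by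
    have hc : ContinuousAt (fun w => ‖w - c‖) z := by fun_prop
    exact (hc.eventually (lt_mem_nhds hz)).and (hc.eventually (gt_mem_nhds hzR))
  have h1 := (HasSupportAt.mul_norm_sq (x := z) (h := fun w => (w - c)⁻¹) ?_ 1).add
    (HasSupportAt.const (-(R ^ 2)⁻¹))
  · rw [add_zero] at h1
    have h2 : HasSupportAt (planarBump c ε R) (fun w => (w - c)⁻¹) 1 z := by
      have hval : ∀ w, ε < ‖w - c‖ →
          1 * ‖(w - c)⁻¹‖ ^ 2 + -(R ^ 2)⁻¹ ≤ planarBump c ε R w := by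
        intro w hw
        refine le_max_of_le_right ?_
        simp only [truncInvSq, if_neg (not_le.2 hw), norm_inv, inv_pow]
        linarith
      refine h1.of_le (hev.mono fun w hw => hval w hw.1) (le_antisymm (hval z hz) ?_)
      have h3 : (R ^ 2)⁻¹ ≤ (‖z - c‖ ^ 2)⁻¹ := by
        have := hε.trans hz
        gcongr
      simp only [planarBump, truncInvSq, if_neg (not_le.2 hz), norm_inv, inv_pow]
      exact max_le (by linarith) (by linarith)
    refine h2.change ?_
    filter_upwards [hev] with w hw
    have hw0 : 0 < ‖w - c‖ := hε.trans hw.1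
    have hz0 : 0 < ‖z - c‖ := hε.trans hz
    have e1 : (w - c)⁻¹ - (z - c)⁻¹ = (z - w) / ((w - c) * (z - c)) := by
      rw [inv_sub_inv (norm_pos_iff.1 hw0) (norm_pos_iff.1 hz0)]
      congr 1
      ring
    rw [e1, norm_div, norm_mul, div_pow, one_mul, norm_sub_rev z w, one_div_mul_eq_div]
    have e2 : (‖w - c‖ * ‖z - c‖) ^ 2 ≤ R ^ 4 := by
      have : ‖w - c‖ * ‖z - c‖ ≤ R * R := by
        have := hw.2.le
        gcongr
      calc _ ≤ (R * R) ^ 2 := by gcongr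
        _ = R ^ 4 := by ring
    simp only [id]
    gcongr
  · filter_upwards [hev] with w hw
    refine mdifferentiableAt_iff_differentiableAt.2 (DifferentiableAt.inv (by fun_prop) ?_)
    exact norm_pos_iff.1 (hε.trans hw.1)

theorem hasSupportAt_planarBump_outside (hε : 0 < ε) (hR : ε < R) (hz : ε < ‖z - c‖) :
    HasSupportAt (planarBump c ε R) id 0 z := by
  rcases lt_or_ge ‖z - c‖ R with h | h
  · exact (hasSupportAt_planarBump_annulus hε hz h).mono (by positivity)
  · exact (HasSupportAt.const 0).of_le (Eventually.of_forall fun _ => planarBump_nonneg)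
      (planarBump_eq_zero hε hR h).symm

end Bump

/-- A bounded function with a simple zero at `a`, whose logarithm is nearly subharmonic. -/
noncomputable def planarPole (a : ℂ) (R : ℝ) (z : ℂ) : ℝ :=
  min ‖z - a‖ R * Real.exp (-(min ‖z - a‖ R ^ 2 / (2 * R ^ 2)))

section Pole

variable {a z : ℂ} {R : ℝ}

theorem continuous_planarPole : Continuous (planarPole a R) := by
  unfold planarPole
  fun_prop

theorem planarPole_nonneg (hR : 0 < R) : 0 ≤ planarPole a R z :=
  mul_nonneg (le_min (norm_nonneg _) hR.le) (Real.exp_pos _).le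

theorem planarPole_le_min (hR : 0 < R) : planarPole a R z ≤ min ‖z - a‖ R := by
  refine mul_le_of_le_one_right (le_min (norm_nonneg _) hR.le) (Real.exp_le_one_iff.2 ?_)
  rw [neg_nonpos]
  positivity

theorem min_le_planarPole (hR : 0 < R) : min ‖z - a‖ R ≤ 2 * planarPole a R z := by
  have hm : 0 ≤ min ‖z - a‖ R := le_min (norm_nonneg _) hR.le
  have h1 : min ‖z - a‖ R ^ 2 / (2 * R ^ 2) ≤ 1 / 2 := by
    rw [div_le_div_iff₀ (by positivity) (by norm_num)]
    have : min ‖z - a‖ R ^ 2 ≤ R ^ 2 := by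
      gcongr
      exact min_le_right _ _
    linarith
  have h2 : 1 / 2 ≤ Real.exp (-(min ‖z - a‖ R ^ 2 / (2 * R ^ 2))) := by
    have := Real.add_one_le_exp (-(min ‖z - a‖ R ^ 2 / (2 * R ^ 2)))
    linarith
  unfold planarPole
  nlinarith [mul_le_mul_of_nonneg_left h2 hm]

theorem planarPole_eq (hz : R ≤ ‖z - a‖) :
    planarPole a R z = R * Real.exp (-(R ^ 2 / (2 * R ^ 2))) := by
  rw [planarPole, min_eq_right hz]

/-- The derivative `1 / q - q` vanishes at `q = 1`, so the loss is only quadratic. This is why the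
exponential factor in `planarPole` makes the truncation at radius `R` harmless. -/
theorem log_ge_quadratic {q : ℝ} (h1 : 1 / 2 ≤ q) :
    -(4 * (1 - q) ^ 2) ≤ Real.log q - q ^ 2 / 2 + 1 / 2 := by
  have hq : 0 < q := by linarith
  have h3 := Real.one_sub_inv_le_log_of_pos hq
  have h4 : q⁻¹ * q = 1 := inv_mul_cancel₀ hq.ne'
  have h5 : q⁻¹ ≤ 2 := by
    rw [inv_le_comm₀ hq (by norm_num)]
    linarith
  have h6 : 1 - q⁻¹ - q ^ 2 / 2 + 1 / 2 = -((1 - q) ^ 2 * (1 / 2 + q⁻¹)) := by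
    linear_combination (q - 2) * h4
  nlinarith [mul_le_mul_of_nonneg_left h5 (sq_nonneg (1 - q)), sq_nonneg (1 - q)]

theorem hasSupportAt_log_planarPole (hR : 0 < R) (hz : z ≠ a) :
    HasSupportAt (fun w => Real.log (planarPole a R w)) id (-(4 / R ^ 2)) z := by
  have hlog : ∀ w, w ≠ a → Real.log (planarPole a R w)
      = Real.log (min ‖w - a‖ R) - min ‖w - a‖ R ^ 2 / (2 * R ^ 2) := by
    intro w hw
    have : 0 < min ‖w - a‖ R := lt_min (norm_pos_iff.2 (sub_ne_zero.2 hw)) hR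
    rw [planarPole, Real.log_mul this.ne' (Real.exp_pos _).ne', Real.log_exp]
    ring
  have hne : ∀ᶠ w in 𝓝 z, w ≠ a := isOpen_ne.mem_nhds hz
  rcases lt_or_ge ‖z - a‖ R with h | h
  · have h1 := (HasSupportAt.mul_log_norm_sub hz 1).add
      (HasSupportAt.mul_norm_sub_sq a (-(1 / (2 * R ^ 2))) z)
    refine (h1.mono (κ' := -(4 / R ^ 2)) ?_).congr ?_
    · rw [zero_add, neg_le_neg_iff, div_le_div_iff₀ (by positivity) (by positivity)]
      nlinarith [sq_nonneg R]
    · have hc : ContinuousAt (fun w => ‖w - a‖) z := by fun_prop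
      filter_upwards [hne, hc.eventually (gt_mem_nhds h)] with w hw hw'
      rw [hlog w hw, min_eq_left hw'.le]
      ring
  · refine ⟨fun _ => (Real.log R - 1 / 2 : ℝ),
      Eventually.of_forall fun _ => mdifferentiableAt_const, ?_, ?_⟩
    · simp only [hlog z hz, min_eq_right h, Complex.ofReal_re]
      field_simp
    · have hball : ball z (R / 2) ∈ 𝓝 z := ball_mem_nhds z (by positivity)
      filter_upwards [hne, hball] with w hw hwb
      rw [hlog w hw, Complex.ofReal_re]
      rw [mem_ball, dist_eq_norm] at hwb
      set m := min ‖w - a‖ R with hm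
      have htri : ‖z - a‖ ≤ ‖w - a‖ + ‖w - z‖ := by
        have := norm_sub_le (w - a) (w - z)
        simpa using this
      have hm1 : R - ‖w - z‖ ≤ m := le_min (by linarith) (by linarith [norm_nonneg (w - z)])
      have hm2 : m ≤ R := min_le_right _ _
      have hmpos : 0 < m := by linarith
      have hq1 : 1 / 2 ≤ m / R := by
        rw [le_div_iff₀ hR]
        linarith
      have hq2 : m / R ≤ 1 := (div_le_one hR).2 hm2
      have key := log_ge_quadratic hq1
      rw [Real.log_div hmpos.ne' hR.ne'] at key
      have h3 : 1 - m / R ≤ ‖w - z‖ / R := by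
        rw [le_div_iff₀ hR, sub_mul, div_mul_cancel₀ _ hR.ne']
        linarith
      have h4 : (1 - m / R) ^ 2 ≤ ‖w - z‖ ^ 2 / R ^ 2 := by
        rw [← div_pow]
        have : 0 ≤ 1 - m / R := by linarith
        gcongr
      have h5 : (m / R) ^ 2 / 2 = m ^ 2 / (2 * R ^ 2) := by
        field_simp
      have h6 : 4 / R ^ 2 * ‖w - z‖ ^ 2 = 4 * (‖w - z‖ ^ 2 / R ^ 2) := by ring
      simp only [id]
      linarith

end Pole

/-! ### Transplanting planar functions to the surface. -/

/-- The function `β ∘ e` on the source of the chart `e`, extended by the constant `k`. -/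
noncomputable def chartGlue {X : Type*} [TopologicalSpace X] (e : OpenPartialHomeomorph X ℂ)
    (β : ℂ → ℝ) (k : ℝ) (x : X) : ℝ :=
  open Classical in if x ∈ e.source then β (e x) else k

section Glue

variable {X : Type*} [TopologicalSpace X] {e : OpenPartialHomeomorph X ℂ} {β : ℂ → ℝ}
  {k : ℝ} {x : X} {c : ℂ} {R : ℝ}

theorem chartGlue_of_mem (hx : x ∈ e.source) : chartGlue e β k x = β (e x) := if_pos hx

theorem chartGlue_of_notMem (hx : x ∉ e.source) : chartGlue e β k x = k := if_neg hx

theorem chartGlue_eventuallyEq (hx : x ∈ e.source) : chartGlue e β k =ᶠ[𝓝 x] β ∘ e := by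
  filter_upwards [e.open_source.mem_nhds hx] with y hy using chartGlue_of_mem hy

theorem isCompact_symm_image (hc : closedBall c R ⊆ e.target) :
    IsCompact (e.symm '' closedBall c R) :=
  (isCompact_closedBall c R).image_of_continuousOn (e.continuousOn_symm.mono hc)

theorem mem_symm_image_iff {s : Set ℂ} (hs : s ⊆ e.target) :
    x ∈ e.symm '' s ↔ x ∈ e.source ∧ e x ∈ s := by
  constructor
  · rintro ⟨z, hz, rfl⟩
    exact ⟨e.map_target (hs hz), by rwa [e.right_inv (hs hz)]⟩
  · rintro ⟨h1, h2⟩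
    exact ⟨e x, h2, e.left_inv h1⟩

/-- The Hausdorff property enters here: the compact image of the chart disc is closed, so the
extension is locally constant even at boundary points of the chart domain. -/
theorem chartGlue_eventuallyEq_const [T2Space X] (hc : closedBall c R ⊆ e.target)
    (hβ : ∀ z, R ≤ ‖z - c‖ → β z = k) (hx : x ∈ e.source → R < ‖e x - c‖) :
    chartGlue e β k =ᶠ[𝓝 x] fun _ => k := by
  have hK : IsClosed (e.symm '' closedBall c R) := (isCompact_symm_image hc).isClosed
  have hxK : x ∉ e.symm '' closedBall c R := by
    rw [mem_symm_image_iff hc, mem_closedBall, dist_eq_norm]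
    rintro ⟨h1, h2⟩
    exact absurd (hx h1) (not_lt.2 h2)
  filter_upwards [hK.isOpen_compl.mem_nhds hxK] with y hy
  rw [mem_compl_iff, mem_symm_image_iff hc, mem_closedBall, dist_eq_norm, not_and, not_le] at hy
  by_cases hys : y ∈ e.source
  · rw [chartGlue_of_mem hys, hβ _ (hy hys).le]
  · exact chartGlue_of_notMem hys

theorem continuous_chartGlue [T2Space X] (hc : closedBall c R ⊆ e.target)
    (hβ : ∀ z, R ≤ ‖z - c‖ → β z = k) (hcont : Continuous β) :
    Continuous (chartGlue e β k) := by
  refine continuous_iff_continuousAt.2 fun x => ?_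
  by_cases hx : x ∈ e.source
  · exact (hcont.continuousAt.comp (e.continuousAt hx)).congr (chartGlue_eventuallyEq hx).symm
  · exact continuousAt_const.congr
      (chartGlue_eventuallyEq_const hc hβ fun h => absurd h hx).symm

end Glue

/-! ### Strictly subharmonic functions off a disc. -/

section Manifold

variable {X : Type*} [TopologicalSpace X] [ChartedSpace ℂ X]
  {e e' : OpenPartialHomeomorph X ℂ} {x : X} {κ : ℝ}

/-- `u` is strictly subharmonic near `p`. -/
def IsStrictNear (u : X → ℝ) (p : X) : Prop :=
  ∃ e ∈ atlas ℂ X, p ∈ e.source ∧ ∃ κ > 0, ∀ᶠ y in 𝓝 p, HasSupportAt u e κ y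

theorem IsStrictNear.eventually {u : X → ℝ} {p : X} (h : IsStrictNear u p) :
    ∀ᶠ q in 𝓝 p, IsStrictNear u q := by
  obtain ⟨e, he, hp, κ, hκ, hu⟩ := h
  filter_upwards [hu.eventually_nhds, e.open_source.mem_nhds hp] with q h1 h2
  exact ⟨e, he, h2, κ, hκ, h1⟩

/-- A bounded continuous function, subharmonic off `K`. -/
structure IsSubharmonicOff (K : Set X) (u : X → ℝ) : Prop where
  continuous : Continuous u
  bounded : ∃ M, ∀ x, |u x| ≤ M
  support : ∀ x ∉ K, HasSupportAt u (fun _ => 0) 0 x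

variable [IsManifold 𝓘(ℂ) 1 X]

theorem eventually_mdifferentiableAt_atlas (he : e ∈ atlas ℂ X) (hx : x ∈ e.source) :
    ∀ᶠ y in 𝓝 x, MDifferentiableAt 𝓘(ℂ) 𝓘(ℂ) e y := by
  filter_upwards [e.open_source.mem_nhds hx] with y hy
  exact mdifferentiableAt_atlas he hy

theorem HasSupportAt.comp_chart {β : ℂ → ℝ} (h : HasSupportAt β id κ (e x))
    (he : e ∈ atlas ℂ X) (hx : x ∈ e.source) : HasSupportAt (β ∘ e) e κ x :=
  h.comp (f := (e : X → ℂ)) (eventually_mdifferentiableAt_atlas he hx)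

theorem HasSupportAt.chartGlue {β : ℂ → ℝ} {k : ℝ} (h : HasSupportAt β id κ (e x))
    (he : e ∈ atlas ℂ X) (hx : x ∈ e.source) : HasSupportAt (chartGlue e β k) e κ x :=
  (h.comp_chart he hx).congr (chartGlue_eventuallyEq hx).symm

/-- Transition maps between two charts are Lipschitz near each point. -/
theorem exists_norm_sub_le_of_atlas (he : e ∈ atlas ℂ X) (he' : e' ∈ atlas ℂ X)
    (hx : x ∈ e.source) (hx' : x ∈ e'.source) :
    ∃ C : ℝ, 0 < C ∧ ∃ U ∈ 𝓝 x, ∀ y ∈ U, ∀ z ∈ U, ‖e' y - e' z‖ ≤ C * ‖e y - e z‖ := by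
  have hcd : ContDiffAt ℂ 1 (e.symm.trans e') (e x) := by
    have h1 := contMDiffAt_symm_of_mem_maximalAtlas (I := 𝓘(ℂ)) (n := 1)
      (IsManifold.subset_maximalAtlas he) (e.map_source hx)
    have h2 := contMDiffAt_of_mem_maximalAtlas (I := 𝓘(ℂ)) (n := 1)
      (IsManifold.subset_maximalAtlas he') hx'
    rw [← e.left_inv hx] at h2
    exact contMDiffAt_iff_contDiffAt.1 (h2.comp (e x) h1)
  obtain ⟨K, t, ht, hK⟩ := hcd.exists_lipschitzOnWith
  refine ⟨K + 1, by positivity, e ⁻¹' t ∩ e.source,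
    inter_mem (e.continuousAt hx ht) (e.open_source.mem_nhds hx), ?_⟩
  rintro y ⟨hy, hys⟩ z ⟨hz, hzs⟩
  have h2 := hK.dist_le_mul _ hy _ hz
  simp only [OpenPartialHomeomorph.coe_trans, Function.comp, e.left_inv hys, e.left_inv hzs,
    dist_eq_norm] at h2
  nlinarith [norm_nonneg (e y - e z)]

/-- Strictness is independent of the chart: `κ` drops by the square of a local Lipschitz constant of
the transition map. -/
theorem IsStrictNear.exists_chart {u : X → ℝ} (h : IsStrictNear u x) (he' : e' ∈ atlas ℂ X)
    (hx' : x ∈ e'.source) : ∃ κ > 0, ∀ᶠ y in 𝓝 x, HasSupportAt u e' κ y := by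
  obtain ⟨e, he, hx, κ, hκ, hu⟩ := h
  obtain ⟨C, hC, U, hU, hle⟩ := exists_norm_sub_le_of_atlas he he' hx hx'
  refine ⟨κ / C ^ 2, by positivity, ?_⟩
  filter_upwards [hu, eventually_mem_nhds_iff.2 hU] with y hy hyU
  refine hy.change ?_
  filter_upwards [hyU] with z hz
  have h1 := hle z hz y (mem_of_mem_nhds hyU)
  calc κ / C ^ 2 * ‖e' z - e' y‖ ^ 2 ≤ κ / C ^ 2 * (C * ‖e z - e y‖) ^ 2 := by gcongr
    _ = κ * ‖e z - e y‖ ^ 2 := by field_simp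

theorem isStrictNear_chartBump (he : e ∈ atlas ℂ X) {c : ℂ} {ε R : ℝ} {p : X} (hε : 0 < ε)
    (hp : p ∈ e.source) (h1 : ε < ‖e p - c‖) (h2 : ‖e p - c‖ < R) :
    IsStrictNear (chartGlue e (planarBump c ε R) 0) p := by
  have hR : 0 < R := (hε.trans h1).trans h2
  refine ⟨e, he, hp, 1 / R ^ 4, by positivity, ?_⟩
  have hc : ContinuousAt (fun y => ‖e y - c‖) p := by
    have := e.continuousAt hp
    fun_prop
  filter_upwards [e.open_source.mem_nhds hp, hc.eventually (lt_mem_nhds h1),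
    hc.eventually (gt_mem_nhds h2)] with y hy h3 h4
  exact (hasSupportAt_planarBump_annulus hε h3 h4).chartGlue he hy

variable [T2Space X] {K : Set X}

theorem isSubharmonicOff_chartBump (he : e ∈ atlas ℂ X) {c : ℂ} {ε R : ℝ} (hε : 0 < ε)
    (hεR : ε < R) (hc : closedBall c R ⊆ e.target) :
    IsSubharmonicOff (e.symm '' closedBall c ε) (chartGlue e (planarBump c ε R) 0) := by
  have hz : ∀ z, R ≤ ‖z - c‖ → planarBump c ε R z = 0 := fun z => planarBump_eq_zero hε hεR
  refine ⟨continuous_chartGlue hc hz (continuous_planarBump hε), ⟨2 / ε ^ 2, fun x => ?_⟩, ?_⟩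
  · by_cases hx : x ∈ e.source
    · rw [chartGlue_of_mem hx, abs_of_nonneg planarBump_nonneg]
      exact planarBump_le hε
    · rw [chartGlue_of_notMem hx, abs_zero]
      positivity
  · intro x hx
    by_cases hxs : x ∈ e.source
    · rw [mem_symm_image_iff ((closedBall_subset_closedBall hεR.le).trans hc), mem_closedBall,
        dist_eq_norm, not_and, not_le] at hx
      exact ((hasSupportAt_planarBump_outside hε hεR (hx hxs)).chartGlue he hxs).zero_change
    · exact (HasSupportAt.const 0).congr
        (chartGlue_eventuallyEq_const hc hz fun h => absurd h hxs).symm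

/-- Strict subharmonicity can be moved across a chart disc lying off `K`. -/
theorem exists_isStrictNear_of_mem_disc (he : e ∈ atlas ℂ X) {p q : X} {R : ℝ}
    (hp : p ∈ e.source) (hq : q ∈ e.source) (hc : closedBall (e q) R ⊆ e.target)
    (hpq : ‖e p - e q‖ < R) (hK : IsClosed K) (hpK : p ∉ K)
    (h : ∃ u, IsSubharmonicOff K u ∧ IsStrictNear u q) :
    ∃ u, IsSubharmonicOff K u ∧ IsStrictNear u p := by
  by_cases hne : p = q
  · rwa [hne]
  obtain ⟨u, hu, hs⟩ := h
  obtain ⟨κ, hκ, hκu⟩ := hs.exists_chart he hq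
  have hpos : 0 < ‖e p - e q‖ := norm_pos_iff.2 (sub_ne_zero.2 fun h => hne (e.injOn hp hq h))
  have hev : ∀ᶠ z in 𝓝 (e q), HasSupportAt u e κ (e.symm z) := by
    have := e.continuousAt_symm (e.map_source hq)
    rw [ContinuousAt, e.left_inv hq] at this
    exact this.eventually hκu
  obtain ⟨r, hr, hball⟩ := Metric.eventually_nhds_iff_ball.1 hev
  -- So small that `u` is still `κ`-strict on the `ε`-disc about `q`, while `p` falls in the annulus
  -- where the bump is strict.
  set ε := min (r / 2) (‖e p - e q‖ / 2) with hεdef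
  have hε : 0 < ε := lt_min (by positivity) (by positivity)
  have hεr : ε < r := (min_le_left _ _).trans_lt (by linarith)
  have hεp : ε < ‖e p - e q‖ := (min_le_right _ _).trans_lt (by linarith)
  have hεR : ε < R := hεp.trans hpq
  set ψ := chartGlue e (planarBump (e q) ε R) 0 with hψ
  have hψsub : IsSubharmonicOff _ ψ := isSubharmonicOff_chartBump he hε hεR hc
  -- The bump loses at most `1 / ε ^ 4` on the inner disc, so this multiple exactly uses up the
  -- strictness of `u`.
  set δ := κ * ε ^ 4 with hδ
  have hδpos : 0 < δ := by positivity
  have hsup : ∀ y ∉ K, HasSupportAt (fun x => u x + δ * ψ x) (fun _ => 0) 0 y := by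
    intro y hy
    by_cases hy' : y ∈ e.symm '' closedBall (e q) ε
    · rw [mem_symm_image_iff ((closedBall_subset_closedBall hεR.le).trans hc)] at hy'
      obtain ⟨hys, hyb⟩ := hy'
      have h1 : HasSupportAt u e κ y := by
        have := hball (e y) (closedBall_subset_ball hεr hyb)
        rwa [e.left_inv hys] at this
      rw [mem_closedBall, dist_eq_norm] at hyb
      have h2 : HasSupportAt ψ e _ y :=
        (hasSupportAt_planarBump_inside hε hεR hyb).chartGlue he hys
      have h3 := h1.add (h2.const_mul hδpos.le)
      have h4 : κ + δ * -(1 / ε ^ 4) = 0 := by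
        rw [hδ]
        field_simp
        ring
      rw [h4] at h3
      exact h3.zero_change
    · simpa using (hu.support y hy).add ((hψsub.support y hy').const_mul hδpos.le)
  refine ⟨fun x => u x + δ * ψ x, ⟨?_, ?_, hsup⟩, ?_⟩
  · exact hu.continuous.add (continuous_const.mul hψsub.continuous)
  · obtain ⟨M, hM⟩ := hu.bounded
    obtain ⟨N, hN⟩ := hψsub.bounded
    refine ⟨M + δ * N, fun x => (abs_add_le _ _).trans ?_⟩
    rw [abs_mul, abs_of_pos hδpos]
    have := hM x
    have := hN x
    gcongr
  · obtain ⟨κ', hκ', hψs⟩ := (isStrictNear_chartBump he hε hp hεp hpq).exists_chart he hp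
    refine ⟨e, he, hp, δ * κ', by positivity, ?_⟩
    filter_upwards [hψs, hK.isOpen_compl.mem_nhds hpK] with y h1 h2
    simpa using (hu.support y h2).zero_change.add (h1.const_mul hδpos.le)

/-- Off a small closed chart disc a connected surface is strictly subharmonic everywhere. -/
theorem exists_isStrictNear [ConnectedSpace X] (he : e ∈ atlas ℂ X) {c : ℂ} {ε R : ℝ}
    (hε : 0 < ε) (hεR : ε < R) (hc : closedBall c R ⊆ e.target) {p : X}
    (hp : p ∉ e.symm '' closedBall c ε) :
    ∃ u, IsSubharmonicOff (e.symm '' closedBall c ε) u ∧ IsStrictNear u p := by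
  have hcε : closedBall c ε ⊆ e.target := (closedBall_subset_closedBall hεR.le).trans hc
  set K := e.symm '' closedBall c ε with hKdef
  have hK : IsClosed K := (isCompact_symm_image hcε).isClosed
  set W := K ∪ {q | ∃ u, IsSubharmonicOff K u ∧ IsStrictNear u q} with hW
  have hopen : IsOpen W := by
    refine isOpen_iff_mem_nhds.2 ?_
    rintro q (hq | ⟨u, hu, hs⟩)
    -- Around a point of `K`, every nearby point outside `K` lies in the annulus of the bump centred
    -- at `c`; this starts the propagation.
    · rw [hKdef, mem_symm_image_iff hcε] at hq
      have hball : ball c R ∈ 𝓝 (e q) :=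
        isOpen_ball.mem_nhds (closedBall_subset_ball hεR hq.2)
      filter_upwards [e.open_source.mem_nhds hq.1, e.continuousAt hq.1 hball] with y hy hyb
      by_cases hyK : y ∈ K
      · exact Or.inl hyK
      · refine Or.inr ⟨_, isSubharmonicOff_chartBump he hε hεR hc,
          isStrictNear_chartBump he hε hy ?_ ?_⟩
        · rw [hKdef, mem_symm_image_iff hcε, mem_closedBall, dist_eq_norm, not_and, not_le] at hyK
          exact hyK hy
        · rwa [mem_preimage, mem_ball, dist_eq_norm] at hyb
    · filter_upwards [hs.eventually] with y hy using Or.inr ⟨u, hu, hy⟩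
  have hclosed : IsClosed W := by
    refine isClosed_of_closure_subset fun q hq => ?_
    by_cases hqK : q ∈ K
    · exact Or.inl hqK
    set f := chartAt ℂ q with hf
    have hqf : q ∈ f.source := mem_chart_source ℂ q
    obtain ⟨r, hr, hrt⟩ := Metric.nhds_basis_closedBall.mem_iff.1
      (f.open_target.mem_nhds (f.map_source hqf))
    have hnhds : f ⁻¹' ball (f q) (r / 2) ∩ f.source ∩ Kᶜ ∈ 𝓝 q :=
      inter_mem (inter_mem (f.continuousAt hqf (ball_mem_nhds _ (by positivity)))
        (f.open_source.mem_nhds hqf)) (hK.isOpen_compl.mem_nhds hqK)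
    obtain ⟨y, ⟨⟨hyb, hys⟩, hyK⟩, hyW⟩ := mem_closure_iff_nhds.1 hq _ hnhds
    rw [mem_preimage, mem_ball] at hyb
    -- The disc of radius `r / 2` about `y` contains `q` and stays in the chart disc of radius `r`
    -- about `q`.
    refine Or.inr (exists_isStrictNear_of_mem_disc (R := r / 2) (chart_mem_atlas ℂ q) hqf hys
      ?_ ?_ hK hqK (hyW.resolve_left hyK))
    · exact (closedBall_subset_closedBall' (by linarith)).trans hrt
    · rwa [← dist_eq_norm, dist_comm]
  have hne : W.Nonempty := ⟨e.symm c, Or.inl ⟨c, mem_closedBall_self hε.le, rfl⟩⟩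
  have huniv := IsClopen.eq_univ ⟨hclosed, hopen⟩ hne
  exact (huniv.symm ▸ mem_univ p : p ∈ W).resolve_left hp

end Manifold

/-! ### A Schwarz lemma for discs off `K`. -/

/-- A holomorphic map from the unit disc to the complement of `K`. -/
structure IsDiscOff {X : Type*} [TopologicalSpace X] [ChartedSpace ℂ X] (K : Set X)
    (f : ℂ → X) : Prop where
  mdifferentiableAt : ∀ z ∈ ball (0 : ℂ) 1, MDifferentiableAt 𝓘(ℂ) 𝓘(ℂ) f z
  notMem : ∀ z ∈ ball (0 : ℂ) 1, f z ∉ K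

section Schwarz

variable {X : Type*} [TopologicalSpace X] [ChartedSpace ℂ X] {K : Set X} {f : ℂ → X}

theorem IsDiscOff.comp_affine (hf : IsDiscOff K f) {w : ℂ} (hw : ‖w‖ ≤ 1 / 4) :
    IsDiscOff K fun z => f (w + z / 2) := by
  have hmaps : ∀ z ∈ ball (0 : ℂ) 1, w + z / 2 ∈ ball (0 : ℂ) 1 := by
    intro z hz
    rw [mem_ball_zero_iff] at hz ⊢
    have h1 := norm_add_le w (z / 2)
    rw [norm_div, Complex.norm_ofNat] at h1
    linarith
  refine ⟨fun z hz => ?_, fun z hz => hf.notMem _ (hmaps z hz)⟩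
  refine (hf.mdifferentiableAt _ (hmaps z hz)).comp z (f := fun z : ℂ => w + z / 2) ?_
  exact mdifferentiableAt_iff_differentiableAt.2 (by fun_prop)

/-- A weak Schwarz lemma for functions with subharmonic logarithm. -/
theorem IsDiscOff.le_mul_sqrt (hf : IsDiscOff K f) {V : X → ℝ} {C D : ℝ} (hV : Continuous V)
    (h0 : ∀ x, 0 ≤ V x) (hC : ∀ x, V x ≤ C) (hD : ∀ᶠ z in 𝓝 (0 : ℂ), V (f z) ≤ D * ‖z‖)
    (hs : ∀ x ∉ K, 0 < V x → HasSupportAt (fun y => Real.log (V y)) (fun _ => 0) 0 x)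
    {z : ℂ} (hz : ‖z‖ ≤ 1 / 2) : V (f z) ≤ 4 * C * √‖z‖ := by
  have hC0 : 0 ≤ C := (h0 (f 0)).trans (hC _)
  have hV0 : V (f 0) = 0 := by
    have := hD.self_of_nhds
    rw [norm_zero, mul_zero] at this
    exact le_antisymm this (h0 _)
  have hball : ∀ w : ℂ, ‖w‖ ≤ 1 / 2 → w ∈ ball (0 : ℂ) 1 := fun w hw => by
    rw [mem_ball_zero_iff]
    linarith
  -- Dividing by the square root rather than by `‖w‖` makes the quotient tend to `0` at the origin.
  -- The factor `exp (‖w‖ ^ 2)` makes `log E` strictly subharmonic, which rules out a positive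
  -- interior maximum.
  set E : ℂ → ℝ := fun w => V (f w) * Real.exp (‖w‖ ^ 2) / √‖w‖ with hE
  have hcont : ContinuousOn E (closedBall 0 (1 / 2)) := by
    intro w hw
    rw [mem_closedBall_zero_iff] at hw
    refine ContinuousAt.continuousWithinAt ?_
    have hnum : ContinuousAt (fun w => V (f w) * Real.exp (‖w‖ ^ 2)) w := by
      have h1 := hV.continuousAt.comp (hf.mdifferentiableAt w (hball w hw)).continuousAt
      have h2 : ContinuousAt (fun w : ℂ => Real.exp (‖w‖ ^ 2)) w := by fun_prop
      exact h1.mul h2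
    by_cases hw0 : w = 0
    · subst hw0
      have hE0 : E 0 = 0 := by simp [hE]
      rw [ContinuousAt, hE0]
      have hlim : Tendsto (fun w : ℂ => D * Real.exp (‖w‖ ^ 2) * √‖w‖) (𝓝 0) (𝓝 0) := by
        have : Continuous fun w : ℂ => D * Real.exp (‖w‖ ^ 2) * √‖w‖ := by fun_prop
        simpa using this.tendsto 0
      refine squeeze_zero' (Eventually.of_forall fun w => ?_) ?_ hlim
      · exact div_nonneg (mul_nonneg (h0 _) (Real.exp_pos _).le) (Real.sqrt_nonneg _)
      · filter_upwards [hD] with w hw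
        calc E w ≤ (D * ‖w‖) * Real.exp (‖w‖ ^ 2) / √‖w‖ := by
              simp only [hE]
              gcongr
          _ = D * Real.exp (‖w‖ ^ 2) * (‖w‖ / √‖w‖) := by ring
          _ = _ := by rw [Real.div_sqrt]
    · refine hnum.div (by fun_prop) ?_
      exact (Real.sqrt_pos.2 (norm_pos_iff.2 hw0)).ne'
  obtain ⟨w, hw, hmax⟩ := (isCompact_closedBall (0 : ℂ) (1 / 2)).exists_isMaxOn
    ⟨0, mem_closedBall_self (by norm_num)⟩ hcont
  have hw' := mem_closedBall_zero_iff.1 hw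
  have hEw : E w ≤ 4 * C := by
    by_contra hcon
    rw [not_le] at hcon
    have hpos : 0 < E w := lt_of_le_of_lt (by positivity) hcon
    have hw0 : w ≠ 0 := by
      rintro rfl
      simp [hE] at hpos
    have hVw : 0 < V (f w) := by
      refine (h0 _).lt_of_ne fun h => ?_
      simp [hE, ← h] at hpos
    rcases hw'.lt_or_eq with hlt | heq
    · have hfc := (hf.mdifferentiableAt w (hball w hw')).continuousAt
      have hnear : ∀ᶠ y in 𝓝 w, y ∈ ball (0 : ℂ) (1 / 2) :=
        isOpen_ball.mem_nhds (mem_ball_zero_iff.2 hlt)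
      have hmd : ∀ᶠ y in 𝓝 w, MDifferentiableAt 𝓘(ℂ) 𝓘(ℂ) f y := by
        filter_upwards [hnear] with y hy
        exact hf.mdifferentiableAt y (hball y (mem_ball_zero_iff.1 hy).le)
      have h1 := ((hs (f w) (hf.notMem w (hball w hw')) hVw).comp hmd).zero_change (ψ := id)
      have h2 := (h1.add (HasSupportAt.mul_log_norm_sub hw0 (-(1 / 2)))).add
        (HasSupportAt.mul_norm_sub_sq 0 1 w)
      refine h2.not_isLocalMax (by norm_num) ?_
      have hVpos : ∀ᶠ y in 𝓝 w, 0 < V (f y) :=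
        (hV.continuousAt.comp hfc).eventually (lt_mem_nhds hVw)
      have hform : ∀ y, y ≠ 0 → 0 < V (f y) →
          Real.log (V (f y)) + -(1 / 2) * Real.log ‖y - 0‖ + 1 * ‖y - 0‖ ^ 2 = Real.log (E y) := by
        intro y hy hy'
        have : 0 < √‖y‖ := Real.sqrt_pos.2 (norm_pos_iff.2 hy)
        simp only [hE]
        rw [Real.log_div (mul_pos hy' (Real.exp_pos _)).ne' this.ne',
          Real.log_mul hy'.ne' (Real.exp_pos _).ne', Real.log_exp, Real.log_sqrt (norm_nonneg _),
          sub_zero]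
        ring
      filter_upwards [hVpos, hnear, isOpen_ne.mem_nhds hw0] with y hy1 hy2 hy3
      simp only [Function.comp]
      rw [hform y hy3 hy1, hform w hw0 hVw]
      refine Real.log_le_log ?_ (hmax (ball_subset_closedBall hy2))
      have : 0 < √‖y‖ := Real.sqrt_pos.2 (norm_pos_iff.2 hy3)
      positivity
    -- On the boundary circle the crude bound `e / 0.7 < 4` gives the constant.
    · have h1 : Real.exp (‖w‖ ^ 2) ≤ 2.7182818286 := by
        refine le_trans (Real.exp_le_exp.2 ?_) Real.exp_one_lt_d9.le
        rw [heq]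
        norm_num
      have h2 : 0.7 ≤ √‖w‖ := by
        rw [heq]
        exact Real.le_sqrt_of_sq_le (by norm_num)
      have h3 : E w ≤ C * 2.7182818286 / 0.7 := by
        simp only [hE]
        have := hC (f w)
        gcongr
      have h4 : C * 2.7182818286 / 0.7 ≤ 4 * C := by
        rw [div_le_iff₀ (by norm_num)]
        linarith
      linarith
  by_cases hz0 : z = 0
  · simp [hz0, hV0]
  · have hsq : 0 < √‖z‖ := Real.sqrt_pos.2 (norm_pos_iff.2 hz0)
    have h1 : E z ≤ 4 * C := (hmax (mem_closedBall_zero_iff.2 hz)).trans hEw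
    simp only [hE] at h1
    rw [div_le_iff₀ hsq] at h1
    refine le_trans (le_mul_of_one_le_right (h0 _) ?_) h1
    exact Real.one_le_exp (sq_nonneg _)

end Schwarz

/-! ### Functions that are Hölder along discs. -/

/-- The chart distance to the point with coordinate `a`, truncated at `R`. -/
noncomputable def chartDist {X : Type*} [TopologicalSpace X] (e : OpenPartialHomeomorph X ℂ)
    (a : ℂ) (R : ℝ) : X → ℝ :=
  chartGlue e (fun z => min ‖z - a‖ R) R

section ChartDist

variable {X : Type*} [TopologicalSpace X] {e : OpenPartialHomeomorph X ℂ} {R : ℝ} {a : ℂ}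

theorem chartDist_le (x : X) : chartDist e a R x ≤ R := by
  unfold chartDist chartGlue
  split_ifs
  exacts [min_le_right _ _, le_rfl]

theorem chartDist_nonneg (hR : 0 ≤ R) (x : X) : 0 ≤ chartDist e a R x := by
  unfold chartDist chartGlue
  split_ifs
  exacts [le_min (norm_nonneg _) hR, hR]

theorem abs_chartDist_sub_le (hR : 0 ≤ R) {b : X} (hb : b ∈ e.source) (y : X) :
    |chartDist e a R y - chartDist e a R b| ≤ chartDist e (e b) R y := by
  unfold chartDist
  rw [chartGlue_of_mem hb]
  by_cases hy : y ∈ e.source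
  · rw [chartGlue_of_mem hy, chartGlue_of_mem hy]
    refine le_min ?_ ?_
    · refine (abs_min_sub_min_le_max _ _ _ _).trans (max_le ?_ (by simp))
      have := abs_norm_sub_norm_le (e y - a) (e b - a)
      simpa using this
    · have h1 : 0 ≤ min ‖e y - a‖ R := le_min (norm_nonneg _) hR
      have h2 : 0 ≤ min ‖e b - a‖ R := le_min (norm_nonneg _) hR
      exact abs_sub_le_of_nonneg_of_le h1 (min_le_right _ _) h2 (min_le_right _ _)
  · rw [chartGlue_of_notMem hy, chartGlue_of_notMem hy]
    have h2 : 0 ≤ min ‖e b - a‖ R := le_min (norm_nonneg _) hR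
    exact abs_sub_le_of_nonneg_of_le hR le_rfl h2 (min_le_right _ _)

end ChartDist

section Hyperbolic

variable {X : Type*} [TopologicalSpace X] [ChartedSpace ℂ X]
  {K : Set X} {e : OpenPartialHomeomorph X ℂ}

/-- Functions with values in `[0, 1]` which are equi-Hölder along all holomorphic discs off `K`. -/
def discFamily (K : Set X) : Set (X → ℝ) :=
  {h | (∀ x, 0 ≤ h x ∧ h x ≤ 1) ∧
    ∀ f, IsDiscOff K f → ∀ z : ℂ, ‖z‖ ≤ 1 / 4 → |h (f z) - h (f 0)| ≤ √‖z‖}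

variable [IsManifold 𝓘(ℂ) 1 X]

/-- A rescaled chart disc about `p` is itself a disc off `K`, so the Hölder bound along it is a
modulus of continuity common to the whole family. -/
theorem discFamily_equicontinuousAt (hK : IsClosed K) {p : X} (hp : p ∉ K) {ε : ℝ} (hε : 0 < ε) :
    ∀ᶠ y in 𝓝 p, ∀ h ∈ discFamily K, |h y - h p| ≤ ε := by
  set e := chartAt ℂ p with he
  have hps : p ∈ e.source := mem_chart_source ℂ p
  have hsymm : Tendsto e.symm (𝓝 (e p)) (𝓝 p) := by
    have := e.continuousAt_symm (e.map_source hps)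
    rwa [ContinuousAt, e.left_inv hps] at this
  obtain ⟨r, hr, hball⟩ := Metric.nhds_basis_ball.mem_iff.1
    (inter_mem (e.open_target.mem_nhds (e.map_source hps))
      (hsymm (hK.isOpen_compl.mem_nhds hp)))
  have hmaps : ∀ z ∈ ball (0 : ℂ) 1, e p + r * z ∈ ball (e p) r := by
    intro z hz
    rw [mem_ball_zero_iff] at hz
    rw [mem_ball, dist_eq_norm, add_sub_cancel_left, norm_mul, Complex.norm_real,
      Real.norm_of_nonneg hr.le]
    exact mul_lt_of_lt_one_right hr hz
  have hf : IsDiscOff K fun z : ℂ => e.symm (e p + r * z) := by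
    refine ⟨fun z hz => ?_, fun z hz => (hball (hmaps z hz)).2⟩
    refine (mdifferentiableAt_atlas_symm (chart_mem_atlas ℂ p) (hball (hmaps z hz)).1).comp z
      (f := fun z : ℂ => e p + r * z) ?_
    exact mdifferentiableAt_iff_differentiableAt.2 (by fun_prop)
  have hlim : Tendsto (fun y => (e y - e p) / r) (𝓝 p) (𝓝 0) := by
    have h1 : ContinuousAt (fun y => (e y - e p) / (r : ℂ)) p := by
      have := e.continuousAt hps
      fun_prop
    simpa using h1.tendsto
  have hlim' : Tendsto (fun y => √‖(e y - e p) / r‖) (𝓝 p) (𝓝 0) := by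
    have h1 : Continuous fun z : ℂ => √‖z‖ := by fun_prop
    have h2 := (h1.tendsto 0).comp hlim
    simp only [norm_zero, Real.sqrt_zero] at h2
    exact h2
  filter_upwards [hlim (closedBall_mem_nhds 0 (by norm_num : (0 : ℝ) < 1 / 4)),
    hlim'.eventually (ge_mem_nhds hε), e.open_source.mem_nhds hps] with y h1 h2 h3 h hh
  have h4 := hh.2 _ hf _ (mem_closedBall_zero_iff.1 h1)
  have hr' : (r : ℂ) ≠ 0 := by exact_mod_cast hr.ne'
  rw [mul_div_cancel₀ _ hr', add_sub_cancel, e.left_inv h3, mul_zero, add_zero,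
    e.left_inv hps] at h4
  exact h4.trans h2

variable [T2Space X]

/-- The Schwarz lemma is applied to `Θ * exp (A * u)`, where `Θ` is the pole at `f 0` and is
comparable to the chart distance. The resulting constant does not depend on `f`. -/
theorem chartDist_disc_le (he : e ∈ atlas ℂ X) {u : X → ℝ} {M κ R : ℝ} {p : X}
    (hu : IsSubharmonicOff K u) (hM : ∀ x, |u x| ≤ M) (hκ : 0 < κ) (hR : 0 < R)
    (hc : closedBall (e p) (2 * R) ⊆ e.target)
    (hs : ∀ y ∈ e.source, ‖e y - e p‖ ≤ 2 * R → HasSupportAt u e κ y)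
    {f : ℂ → X} (hf : IsDiscOff K f) (h0 : f 0 ∈ e.source) (h0' : ‖e (f 0) - e p‖ < R)
    {z : ℂ} (hz : ‖z‖ ≤ 1 / 2) :
    chartDist e (e (f 0)) R (f z) ≤ 8 * R * Real.exp (4 / (R ^ 2 * κ) * M) ^ 2 * √‖z‖ := by
  -- Chosen so that `A * κ` cancels the defect `-(4 / R ^ 2)` of the logarithm of the pole.
  set A := 4 / (R ^ 2 * κ) with hA
  have hApos : 0 < A := by positivity
  set a := e (f 0) with ha
  set k := R * Real.exp (-(R ^ 2 / (2 * R ^ 2))) with hk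
  have hca : closedBall a R ⊆ e.target := by
    refine (closedBall_subset_closedBall' ?_).trans hc
    rw [dist_eq_norm]
    linarith
  have hpk : ∀ w, R ≤ ‖w - a‖ → planarPole a R w = k := fun w hw => planarPole_eq hw
  set Θ := chartGlue e (planarPole a R) k with hΘ
  have hΘcont : Continuous Θ := continuous_chartGlue hca hpk continuous_planarPole
  have hkpos : 0 < k := by positivity
  have hΘ0 : ∀ x, 0 ≤ Θ x := by
    intro x
    simp only [hΘ, chartGlue]
    split_ifs
    exacts [planarPole_nonneg hR, hkpos.le]
  have hkR : k ≤ R := by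
    refine mul_le_of_le_one_right hR.le (Real.exp_le_one_iff.2 ?_)
    rw [neg_nonpos]
    positivity
  have hΘR : ∀ x, Θ x ≤ R := by
    intro x
    simp only [hΘ, chartGlue]
    split_ifs
    exacts [(planarPole_le_min hR).trans (min_le_right _ _), hkR]
  have hdist : ∀ x, chartDist e a R x ≤ 2 * Θ x := by
    intro x
    by_cases hx : x ∈ e.source
    · rw [hΘ, chartDist, chartGlue_of_mem hx, chartGlue_of_mem hx]
      exact min_le_planarPole hR
    · rw [hΘ, chartDist, chartGlue_of_notMem hx, chartGlue_of_notMem hx]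
      -- Evaluating at a point at distance exactly `R` from `a` gives `R ≤ 2 * k`.
      have := min_le_planarPole (a := a) (z := a + R) hR
      rw [planarPole_eq] at this <;> simp [abs_of_pos hR] at this ⊢
      exact this
  set V : X → ℝ := fun x => Θ x * Real.exp (A * u x) with hV
  have hAu : ∀ x, A * u x ≤ A * M ∧ -(A * M) ≤ A * u x := by
    intro x
    have := abs_le.1 (hM x)
    constructor <;> nlinarith
  have hVle : ∀ x, V x ≤ Θ x * Real.exp (A * M) := fun x =>
    mul_le_mul_of_nonneg_left (Real.exp_le_exp.2 (hAu x).1) (hΘ0 x)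
  have hfd := hf.mdifferentiableAt 0 (mem_ball_self one_pos)
  have hd : DifferentiableAt ℂ (e ∘ f) 0 := mdifferentiableAt_iff_differentiableAt.1
    ((mdifferentiableAt_atlas he h0).comp (0 : ℂ) hfd)
  obtain ⟨D, hD⟩ := hd.hasFDerivAt.isBigO_sub.bound
  have hsch := hf.le_mul_sqrt (V := V) (C := R * Real.exp (A * M)) (D := D * Real.exp (A * M))
    ?_ ?_ ?_ ?_ ?_ hz
  · have h1 : Θ (f z) ≤ Real.exp (A * M) * V (f z) := by
      have h2 : 1 ≤ Real.exp (A * M) * Real.exp (A * u (f z)) := by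
        rw [← Real.exp_add]
        exact Real.one_le_exp (by linarith [(hAu (f z)).2])
      calc Θ (f z) ≤ Θ (f z) * (Real.exp (A * M) * Real.exp (A * u (f z))) :=
            le_mul_of_one_le_right (hΘ0 _) h2
        _ = _ := by
            simp only [hV]
            ring
    have h3 := mul_le_mul_of_nonneg_left hsch (Real.exp_pos (A * M)).le
    calc _ ≤ 2 * Θ (f z) := hdist _
      _ ≤ 2 * (Real.exp (A * M) * (4 * (R * Real.exp (A * M)) * √‖z‖)) := by linarith
      _ = _ := by ring
  · exact hΘcont.mul (Real.continuous_exp.comp (continuous_const.mul hu.continuous))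
  · exact fun x => mul_nonneg (hΘ0 x) (Real.exp_pos _).le
  · intro x
    exact (hVle x).trans (mul_le_mul_of_nonneg_right (hΘR x) (Real.exp_pos _).le)
  · filter_upwards [hD, hfd.continuousAt (e.open_source.mem_nhds h0)] with w hw hws
    have hws' : f w ∈ e.source := hws
    have h2 : Θ (f w) ≤ D * ‖w‖ := by
      rw [hΘ, chartGlue_of_mem hws']
      refine ((planarPole_le_min hR).trans (min_le_left _ _)).trans ?_
      simpa using hw
    calc V (f w) ≤ Θ (f w) * Real.exp (A * M) := hVle _
      _ ≤ (D * ‖w‖) * Real.exp (A * M) := by gcongr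
      _ = _ := by ring
  · intro x hx hVx
    have hΘx : 0 < Θ x := by
      refine (hΘ0 x).lt_of_ne fun h => ?_
      simp [hV, ← h] at hVx
    have hlogV : (fun y => Real.log (Θ y) + A * u y) =ᶠ[𝓝 x] fun y => Real.log (V y) := by
      filter_upwards [hΘcont.continuousAt.eventually (lt_mem_nhds hΘx)] with y hy
      rw [hV, Real.log_mul hy.ne' (Real.exp_pos _).ne', Real.log_exp]
    refine HasSupportAt.congr ?_ hlogV
    -- On the `R`-disc about `a`, inside the `2 * R`-disc about `e p`, strictness of `u` pays for
    -- the pole. Elsewhere `Θ` is locally constant.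
    by_cases hxs : x ∈ e.source ∧ ‖e x - a‖ ≤ R
    · have hxa : e x ≠ a := by
        intro h
        rw [hΘ, chartGlue_of_mem hxs.1, h] at hΘx
        simp [planarPole, hR.le] at hΘx
      have h1 := ((hasSupportAt_log_planarPole hR hxa).comp_chart he hxs.1).congr
        (v := fun y => Real.log (Θ y))
        ((chartGlue_eventuallyEq (β := planarPole a R) (k := k) hxs.1).mono fun y hy => by
          simp only [hΘ, hy, Function.comp])
      have h2 : ‖e x - e p‖ ≤ 2 * R := by
        have := norm_sub_le_norm_sub_add_norm_sub (e x) a (e p)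
        linarith [hxs.2]
      have h3 := h1.add ((hs x hxs.1 h2).const_mul hApos.le)
      have h4 : -(4 / R ^ 2) + A * κ = 0 := by
        rw [hA]
        field_simp
        ring
      rw [h4] at h3
      exact h3.zero_change
    · have h1 := chartGlue_eventuallyEq_const hca hpk (x := x) fun h => by
        by_contra hcon
        exact hxs ⟨h, not_lt.1 hcon⟩
      have h2 := (HasSupportAt.const (φ := fun _ : X => 0) (x := x) (Real.log k)).congr
        (v := fun y => Real.log (Θ y)) (h1.mono fun y hy => by simp only [hΘ, hy])
      simpa using h2.add ((hu.support x hx).const_mul hApos.le)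

theorem exists_mem_discFamily {p : X} {u : X → ℝ} (hu : IsSubharmonicOff K u)
    (hs : IsStrictNear u p) {U : Set X} (hU : U ∈ 𝓝 p) :
    ∃ h ∈ discFamily K, 0 < h p ∧ ∀ y ∉ U, h y = 0 := by
  obtain ⟨e, he, hp, κ, hκ, hκu⟩ := hs
  obtain ⟨M, hM⟩ := hu.bounded
  have hsymm : Tendsto e.symm (𝓝 (e p)) (𝓝 p) := by
    have := e.continuousAt_symm (e.map_source hp)
    rwa [ContinuousAt, e.left_inv hp] at this
  obtain ⟨r, hr, hball⟩ := Metric.nhds_basis_closedBall.mem_iff.1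
    (inter_mem (e.open_target.mem_nhds (e.map_source hp)) (hsymm (inter_mem hU hκu)))
  obtain ⟨R, rfl⟩ : ∃ R, r = 2 * R := ⟨r / 2, by ring⟩
  have hR : 0 < R := by linarith
  have hmem : ∀ y ∈ e.source, ‖e y - e p‖ ≤ 2 * R → y ∈ U ∧ HasSupportAt u e κ y := by
    intro y hy hyR
    have h1 := (hball (mem_closedBall_iff_norm.2 hyR)).2
    rw [mem_preimage, e.left_inv hy] at h1
    exact h1
  set C := 8 * R * Real.exp (4 / (R ^ 2 * κ) * M) ^ 2 with hC
  have hCpos : 0 < C := by positivity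
  set F := chartDist e (e p) R with hF
  have hdisc : ∀ f, IsDiscOff K f → F (f 0) < R → ∀ z : ℂ, ‖z‖ ≤ 1 / 2 →
      |F (f z) - F (f 0)| ≤ C * √‖z‖ := by
    intro f hf hlt z hz
    have h0 : f 0 ∈ e.source := by
      by_contra hcon
      rw [hF, chartDist, chartGlue_of_notMem hcon] at hlt
      exact lt_irrefl _ hlt
    have h0' : ‖e (f 0) - e p‖ < R := by
      rw [hF, chartDist, chartGlue_of_mem h0] at hlt
      rcases min_lt_iff.1 hlt with h | h
      exacts [h, absurd h (lt_irrefl _)]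
    exact (abs_chartDist_sub_le hR.le h0 _).trans
      (chartDist_disc_le he hu hM hκ hR (hball.trans inter_subset_left)
        (fun y hy hy' => (hmem y hy hy').2) hf h0 h0' hz)
  have hdisc' : ∀ f, IsDiscOff K f → ∀ z : ℂ, ‖z‖ ≤ 1 / 4 →
      |F (f z) - F (f 0)| ≤ 2 * C * √‖z‖ := by
    intro f hf z hz
    have hsq := Real.sqrt_nonneg ‖z‖
    by_cases h0 : F (f 0) < R
    · have := hdisc f hf h0 z (by linarith)
      nlinarith
    by_cases h1 : F (f z) < R
    -- Only the endpoint `f z` is close to `p`, so the disc is recentred there. In the halved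
    -- coordinate the old centre is `-(2 * z)`, of norm at most `1 / 2`.
    · have h2 : ‖-(2 * z)‖ = 2 * ‖z‖ := by simp
      have h3 := hdisc _ (hf.comp_affine hz) (by simpa using h1) (-(2 * z)) (by linarith)
      have h4 : z + -(2 * z) / 2 = 0 := by ring
      rw [h4, h2, zero_div, add_zero, abs_sub_comm] at h3
      refine h3.trans ?_
      have h5 : √(2 * ‖z‖) ≤ 2 * √‖z‖ := by
        refine Real.sqrt_le_iff.2 ⟨by positivity, ?_⟩
        rw [mul_pow, Real.sq_sqrt (norm_nonneg _)]
        linarith [norm_nonneg z]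
      nlinarith
    · have e0 : F (f 0) = R := le_antisymm (chartDist_le _) (not_lt.1 h0)
      have e1 : F (f z) = R := le_antisymm (chartDist_le _) (not_lt.1 h1)
      rw [e0, e1, sub_self, abs_zero]
      positivity
  -- One entry normalises the values to `[0, 1]`, the other the Hölder constant to `1`.
  set c := min R⁻¹ (2 * C)⁻¹ with hc
  have hcpos : 0 < c := lt_min (by positivity) (by positivity)
  refine ⟨fun x => c * (R - F x), ⟨fun x => ⟨?_, ?_⟩, fun f hf z hz => ?_⟩, ?_, fun y hy => ?_⟩
  · exact mul_nonneg hcpos.le (sub_nonneg.2 (chartDist_le x))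
  · have h1 : 0 ≤ F x := chartDist_nonneg hR.le x
    calc c * (R - F x) ≤ R⁻¹ * R :=
          mul_le_mul (min_le_left _ _) (by linarith) (sub_nonneg.2 (chartDist_le x))
            (by positivity)
      _ = 1 := inv_mul_cancel₀ hR.ne'
  · have h1 : c * (R - F (f z)) - c * (R - F (f 0)) = -(c * (F (f z) - F (f 0))) := by ring
    rw [h1, abs_neg, abs_mul, abs_of_pos hcpos]
    calc c * |F (f z) - F (f 0)| ≤ (2 * C)⁻¹ * (2 * C * √‖z‖) :=
          mul_le_mul (min_le_right _ _) (hdisc' f hf z hz) (abs_nonneg _) (by positivity)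
      _ = √‖z‖ := by field_simp
  · have : F p = 0 := by
      rw [hF, chartDist, chartGlue_of_mem hp]
      simp [hR.le]
    simp only [this, sub_zero]
    positivity
  · have : F y = R := by
      by_cases hys : y ∈ e.source
      · rw [hF, chartDist, chartGlue_of_mem hys]
        refine min_eq_right ?_
        by_contra hcon
        exact hy (hmem y hys (by linarith [not_le.1 hcon])).1
      · exact chartGlue_of_notMem hys
    simp [this]

end Hyperbolic

/-! ### Topological lemmas. -/

/-- A connected, locally compact, paracompact Hausdorff space is `σ`-compact. -/
theorem sigmaCompactSpace_of_paracompact_of_connected (Y : Type*) [TopologicalSpace Y] [T2Space Y]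
    [LocallyCompactSpace Y] [ParacompactSpace Y] [ConnectedSpace Y] : SigmaCompactSpace Y := by
  choose N hN hNmem using fun y : Y => exists_compact_mem_nhds y
  obtain ⟨v, hvo, hvc, hvf, hvN⟩ := precise_refinement (fun y => interior (N y))
    (fun _ => isOpen_interior)
    (iUnion_eq_univ_iff.2 fun y => ⟨y, mem_interior_iff_mem_nhds.2 (hNmem y)⟩)
  have hstep : ∀ A : Set Y, IsCompact A → ∃ B, IsCompact B ∧
      ∀ y, (v y ∩ A).Nonempty → v y ⊆ B := by
    intro A hA
    have hfin := hvf.finite_nonempty_inter_compact hA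
    exact ⟨⋃ y ∈ {y | (v y ∩ A).Nonempty}, N y, hfin.isCompact_biUnion fun y _ => hN y,
      fun y hy => ((hvN y).trans interior_subset).trans
        (subset_biUnion_of_mem (u := fun y => N y) hy)⟩
  choose! B hB hBsub using hstep
  obtain ⟨x₀⟩ := (inferInstance : Nonempty Y)
  let S : ℕ → Set Y := fun n => B^[n] {x₀}
  have hS : ∀ n, IsCompact (S n) := by
    intro n
    induction n with
    | zero => exact isCompact_singleton
    | succ n ih =>
      simp only [S, Function.iterate_succ_apply']
      exact hB _ ih
  have hnext : ∀ n y, (v y ∩ S n).Nonempty → v y ⊆ S (n + 1) := by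
    intro n y hy
    simp only [S, Function.iterate_succ_apply']
    exact hBsub _ (hS n) y hy
  have hcov : ∀ x, ∃ y, x ∈ v y := iUnion_eq_univ_iff.1 hvc
  have hclopen : IsClopen (⋃ n, S n) := by
    constructor
    · refine isClosed_of_closure_subset fun x hx => ?_
      obtain ⟨y, hy⟩ := hcov x
      obtain ⟨w, hwv, hw⟩ := mem_closure_iff.1 hx _ (hvo y) hy
      obtain ⟨n, hn⟩ := mem_iUnion.1 hw
      exact mem_iUnion.2 ⟨n + 1, hnext n y ⟨w, hwv, hn⟩ hy⟩
    · refine isOpen_iff_mem_nhds.2 fun x hx => ?_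
      obtain ⟨y, hy⟩ := hcov x
      obtain ⟨n, hn⟩ := mem_iUnion.1 hx
      exact mem_of_superset ((hvo y).mem_nhds hy)
        ((hnext n y ⟨x, hy, hn⟩).trans (subset_iUnion S (n + 1)))
  refine SigmaCompactSpace_iff_exists_compact_covering.2 ⟨S, hS, ?_⟩
  exact hclopen.eq_univ ⟨x₀, mem_iUnion.2 ⟨0, rfl⟩⟩

theorem isPreconnected_annulus (c : ℂ) {ε R : ℝ} (hε : 0 < ε) :
    IsPreconnected {z : ℂ | ε < ‖z - c‖ ∧ ‖z - c‖ < R} := by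
  have h1 : IsPreconnected (Ioo ε R ×ˢ (univ : Set ℝ)) :=
    isPreconnected_Ioo.prod isPreconnected_univ
  have h2 := h1.image (fun q : ℝ × ℝ => c + q.1 * Complex.exp (q.2 * Complex.I))
    (by fun_prop)
  convert h2 using 1
  ext z
  constructor
  · intro hz
    refine ⟨(‖z - c‖, Complex.arg (z - c)), ⟨hz, mem_univ _⟩, ?_⟩
    simp only [Complex.norm_mul_exp_arg_mul_I]
    ring
  · rintro ⟨q, ⟨hq, -⟩, rfl⟩
    have : ‖c + q.1 * Complex.exp (q.2 * Complex.I) - c‖ = q.1 := by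
      rw [add_sub_cancel_left, norm_mul, Complex.norm_exp_ofReal_mul_I, mul_one,
        Complex.norm_real, Real.norm_of_nonneg (hε.trans hq.1).le]
    rw [mem_ofPred_eq, this]
    exact hq

/-- Removing a small closed chart disc from a connected surface leaves it connected. -/
theorem isConnected_compl_disc {X : Type*} [TopologicalSpace X] [T2Space X] [ConnectedSpace X]
    {e : OpenPartialHomeomorph X ℂ} {c : ℂ}
    {ε R : ℝ} (hε : 0 < ε) (hεR : ε < R) (hc : closedBall c R ⊆ e.target) :
    IsConnected (e.symm '' closedBall c ε)ᶜ := by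
  have hcε : closedBall c ε ⊆ e.target := (closedBall_subset_closedBall hεR.le).trans hc
  have hcR : ball c R ⊆ e.target := ball_subset_closedBall.trans hc
  set K := e.symm '' closedBall c ε with hKdef
  have hK : IsClosed K := (isCompact_symm_image hcε).isClosed
  set D := e.symm '' ball c R with hD
  have hDo : IsOpen D := e.isOpen_image_symm_of_subset_target isOpen_ball hcR
  have hKD : K ⊆ D := image_mono (closedBall_subset_ball hεR)
  have hann : {z : ℂ | ε < ‖z - c‖ ∧ ‖z - c‖ < R} ⊆ e.target := fun z hz =>
    hcR (mem_ball_iff_norm.2 hz.2)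
  set A := e.symm '' {z : ℂ | ε < ‖z - c‖ ∧ ‖z - c‖ < R} with hA
  have hAconn : IsPreconnected A :=
    (isPreconnected_annulus c hε).image _ (e.continuousOn_symm.mono hann)
  have hAK : A ⊆ Kᶜ := by
    intro x hx hxK
    have h1 := ((mem_symm_image_iff hann).1 hx).2.1
    have h2 := mem_closedBall_iff_norm.1 ((mem_symm_image_iff hcε).1 hxK).2
    exact absurd h1 (not_lt.2 h2)
  have hDA : ∀ x ∈ D, x ∉ K → x ∈ A := by
    intro x hx hxK
    obtain ⟨h1, h2⟩ := (mem_symm_image_iff hcR).1 hx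
    refine (mem_symm_image_iff hann).2 ⟨h1, ?_, mem_ball_iff_norm.1 h2⟩
    by_contra hcon
    exact hxK ((mem_symm_image_iff hcε).2 ⟨h1, mem_closedBall_iff_norm.2 (not_lt.1 hcon)⟩)
  have hAne : A.Nonempty := by
    refine ⟨_, c + ((ε + R) / 2 : ℝ), ?_, rfl⟩
    rw [mem_ofPred_eq, add_sub_cancel_left, Complex.norm_real, Real.norm_of_nonneg (by linarith)]
    constructor <;> linarith
  -- If the annulus lies in `u`, then filling `K` back in on that side leaves `Kᶜ ∩ v` clopen in
  -- `X`, against connectedness.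
  have main : ∀ u v : Set X, IsOpen u → IsOpen v → Kᶜ ⊆ u ∪ v → ¬ (Kᶜ ∩ (u ∩ v)).Nonempty →
      A ⊆ u → (Kᶜ ∩ v).Nonempty → False := by
    intro u v hu hv hcov hdisj hAu hvne
    have hdisj' : ∀ x, x ∉ K → x ∈ u → x ∉ v := fun x h1 h2 h3 => hdisj ⟨x, h1, h2, h3⟩
    have hcompl : (Kᶜ ∩ v)ᶜ = (Kᶜ ∩ u) ∪ D := by
      ext x
      constructor
      · intro hx
        by_cases hxK : x ∈ K
        · exact Or.inr (hKD hxK)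
        · exact Or.inl ⟨hxK, (hcov hxK).resolve_right fun h => hx ⟨hxK, h⟩⟩
      · rintro (⟨h1, h2⟩ | h) ⟨h3, h4⟩
        · exact hdisj' x h1 h2 h4
        · exact hdisj' x h3 (hAu (hDA x h h3)) h4
    have hclopen : IsClopen (Kᶜ ∩ v) := by
      refine ⟨⟨?_⟩, hK.isOpen_compl.inter hv⟩
      rw [hcompl]
      exact (hK.isOpen_compl.inter hu).union hDo
    have huniv := hclopen.eq_univ hvne
    obtain ⟨x, hx⟩ := hAne
    have h1 : x ∈ Kᶜ ∩ v := huniv.symm ▸ mem_univ x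
    exact hdisj' x h1.1 (hAu hx) h1.2
  refine ⟨hAne.mono hAK, fun u v hu hv hcov hune hvne => ?_⟩
  by_contra hdisj
  have hsub := hAconn.subset_or_subset (hK.isOpen_compl.inter hu) (hK.isOpen_compl.inter hv)
    (disjoint_left.2 fun x h1 h2 => hdisj ⟨x, h1.1, h1.2, h2.2⟩)
    fun x hx => (hcov (hAK hx)).imp (fun h => ⟨hAK hx, h⟩) fun h => ⟨hAK hx, h⟩
  rcases hsub with h | h
  · exact main u v hu hv hcov hdisj (h.trans inter_subset_right) hvne
  · refine main v u hv hu (by rwa [union_comm]) (by rwa [inter_comm v u])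
      (h.trans inter_subset_right) hune

/-! ### Pseudo-metrizability off the disc, and the conclusion. -/

section Final

variable {X : Type*} [TopologicalSpace X] [ChartedSpace ℂ X] [IsManifold 𝓘(ℂ) 1 X] [T2Space X]

/-- Evaluation maps `Kᶜ` into the bounded functions on `discFamily K` with the supremum metric.
Equicontinuity makes this continuous, and the bumps of small support make it inducing. -/
theorem pseudoMetrizableSpace_compl {K : Set X} (hK : IsClosed K)
    (hs : ∀ p ∉ K, ∃ u, IsSubharmonicOff K u ∧ IsStrictNear u p) :
    TopologicalSpace.PseudoMetrizableSpace (Kᶜ : Set X) := by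
  let : TopologicalSpace (discFamily K) := ⊥
  have : DiscreteTopology (discFamily K) := ⟨rfl⟩
  let Φ : (Kᶜ : Set X) → BoundedContinuousFunction (discFamily K) ℝ := fun y =>
    BoundedContinuousFunction.ofNormedAddCommGroup (fun h => h.1 y) continuous_of_discreteTopology 1
      fun h => by
        rw [Real.norm_of_nonneg (h.2.1 y).1]
        exact (h.2.1 y).2
  have hΦ : IsInducing Φ := by
    refine isInducing_iff_nhds.2 fun p => le_antisymm ?_ ?_
    · refine tendsto_iff_comap.1 (Metric.tendsto_nhds.2 fun ε hε => ?_)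
      have h1 := discFamily_equicontinuousAt hK p.2 (half_pos hε)
      filter_upwards [continuous_subtype_val.continuousAt.eventually h1] with y hy
      refine lt_of_le_of_lt ((BoundedContinuousFunction.dist_le (half_pos hε).le).2 fun h => ?_)
        (half_lt_self hε)
      exact hy h.1 h.2
    · intro U hU
      rw [nhds_subtype_eq_comap, mem_comap] at hU
      obtain ⟨W, hW, hWU⟩ := hU
      obtain ⟨u, hu, hup⟩ := hs p p.2
      obtain ⟨h, hh, hp, h0⟩ := exists_mem_discFamily hu hup hW
      -- The radius `h p` suffices: outside `W` the bump vanishes, so the distance to `Φ p` is at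
      -- least `h p`.
      refine mem_comap.2 ⟨ball (Φ p) (h p), ball_mem_nhds _ hp, fun y hy => hWU ?_⟩
      by_contra hcon
      have h1 := (BoundedContinuousFunction.dist_coe_le_dist (f := Φ y) (g := Φ p)
        ⟨h, hh⟩).trans_lt (mem_ball.1 hy)
      have h2 : dist (h y) (h p) < h p := h1
      rw [h0 y hcon, dist_zero_left, Real.norm_of_nonneg hp.le] at h2
      exact lt_irrefl _ h2
  exact hΦ.pseudoMetrizableSpace

theorem secondCountableTopology_of_connected [ConnectedSpace X] : SecondCountableTopology X := by
  obtain ⟨x⟩ := (inferInstance : Nonempty X)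
  set e := chartAt ℂ x
  have he : e ∈ atlas ℂ X := chart_mem_atlas ℂ x
  have hx : x ∈ e.source := mem_chart_source ℂ x
  obtain ⟨R, hR, hc⟩ := Metric.nhds_basis_closedBall.mem_iff.1
    (e.open_target.mem_nhds (e.map_source hx))
  have hε : 0 < R / 2 := by positivity
  have hεR : R / 2 < R := by linarith
  set K := e.symm '' closedBall (e x) (R / 2) with hKdef
  have hcε : closedBall (e x) (R / 2) ⊆ e.target :=
    (closedBall_subset_closedBall hεR.le).trans hc
  have hK : IsClosed K := (isCompact_symm_image hcε).isClosed
  have : TopologicalSpace.PseudoMetrizableSpace (Kᶜ : Set X) :=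
    pseudoMetrizableSpace_compl hK fun p hp => exists_isStrictNear he hε hεR hc hp
  have : ConnectedSpace (Kᶜ : Set X) :=
    isConnected_iff_connectedSpace.1 (isConnected_compl_disc hε hεR hc)
  have : LocallyCompactSpace X := ChartedSpace.locallyCompactSpace ℂ X
  have : LocallyCompactSpace (Kᶜ : Set X) := hK.isOpen_compl.locallyCompactSpace
  let := TopologicalSpace.pseudoMetrizableSpacePseudoMetric (Kᶜ : Set X)
  have : SigmaCompactSpace (Kᶜ : Set X) := sigmaCompactSpace_of_paracompact_of_connected _
  have h1 : SecondCountableTopology (Kᶜ : Set X) := inferInstance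
  have h2 : SecondCountableTopology e.source := e.secondCountableTopology_source
  have h3 : ∀ b : Bool, SecondCountableTopology (cond b Kᶜ e.source : Set X) := by
    rintro (_ | _)
    exacts [h2, h1]
  refine TopologicalSpace.secondCountableTopology_of_countable_cover
    (U := fun b : Bool => cond b Kᶜ e.source) ?_ (iUnion_eq_univ_iff.2 fun y => ?_)
  · rintro (_ | _)
    exacts [e.open_source, hK.isOpen_compl]
  · by_cases hy : y ∈ K
    · exact ⟨false, ((mem_symm_image_iff hcε).1 hy).1⟩
    · exact ⟨true, hy⟩

end Final

theorem mainTheorem4 (X : Type*) [TopologicalSpace X] [T2Space X] [ConnectedSpace X]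
    [ChartedSpace ℂ X] [IsManifold 𝓘(ℂ) 1 X] :
    SecondCountableTopology X :=
  secondCountableTopology_of_connected
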